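/- Let $\lambda$ be a self-conjugate integer partition, $\lambda=\lambda'$, identified with its Young diagram $\{(i,j): 1\le i\le \ell(\lambda),\ 1\le j\le \lambda_i\}$, where $\ell(\lambda)$ is the number of nonzero parts. Write $\lambda$ in multirectangular coordinates, $\lambda=(b_1^{a_1},b_2^{a_2},\ldots,b_r^{a_r})$, where $a_i,b_i$ are positive integers, $b_1>b_2>\cdots>b_r$, and $b_i^{a_i}$ means that the part $b_i$ occurs $a_i$ times. Then $b_i=a_1+\cdots+a_{r-i+1}$ for $1\le i\le r$, i.e. $$\lambda=\big((a_1+a_2+\cdots+a_r)^{a_1},(a_1+a_2+\cdots+a_{r-1})^{a_2},\ldots,a_1^{a_r}\big).$$ A $\lambda$-plane tree is a pair $(T,c)$, where $T$ is a plane (rooted, ordered) tree and $c$ is a labelling of its vertices by elements of $\{1,\ldots,\ell(\lambda)\}$ such that $(c(u),c(v))\in\lambda$ whenever $\{u,v\}$ is an edge of $T$. For every integer $k\ge 1$, the number $C_k^\lambda$ of $\lambda$-plane trees on $k+1$ vertices is $$C_k^{\lambda}=\sum_{\substack{\ell_1,\ldots,\ell_r\ge 0\\ \ell_1+\cdots+\ell_r=k+1}}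 t(\ell_1,\ldots,\ell_r)\,a_1^{\ell_1}\cdots a_r^{\ell_r},$$ where $$t(\ell_1,\ldots,\ell_r)=\frac1k\prod_{j=1}^{r}\binom{\ell_{\ge j}+\ell_{\le r-j+1}-1-\mathbf 1_{\{j\le\lceil r/2\rceil\}}}{\ell_j},$$ with $\ell_{\le i}=\ell_1+\cdots+\ell_i$, $\ell_{\ge i}=\ell_i+\cdots+\ell_r$, and $\binom{n}{m}=n(n-1)\cdots(n-m+1)/m!$ for integers $n$ and $m\ge 0$ (so that $\binom{n}{0}=1$ also for $n=-1$). -/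

import Mathlib

/-- Finite plane (that is, rooted and ordered) trees whose vertices carry labels in `α`:
a labelled root together with the ordered list of its subtrees. An element is the same thing as a
pair `(T, c)` of a plane tree `T` and a labelling `c` of its vertices by elements of `α`. -/
inductive LabelledPlaneTree (α : Type) : Type
  | node (label : α) (subtrees : List (LabelledPlaneTree α)) : LabelledPlaneTree α

namespace LabelledPlaneTree

/-- The label of the root. -/
def rootLabel {α : Type} : LabelledPlaneTree α → α
  | node x _ => x

/-- The number of vertices. -/
def numVertices {α : Type} : LabelledPlaneTree α → ℕ
  | node _ ts => 1 + (ts.map numVertices).sum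

/-- `T.EdgesSatisfy R`: every edge of `T`, between a parent labelled `x` and a child labelled `y`,
satisfies `R x y`. -/
inductive EdgesSatisfy {α : Type} (R : α → α → Prop) : LabelledPlaneTree α → Prop
  | node (x : α) (ts : List (LabelledPlaneTree α))
      (edges_root : ∀ t ∈ ts, R x t.rootLabel)
      (edges_subtrees : ∀ t ∈ ts, EdgesSatisfy R t) : EdgesSatisfy R (LabelledPlaneTree.node x ts)

end LabelledPlaneTree

/-- The length `ℓ(λ)` of a partition, i.e. the number of rows of its Young diagram. -/
def partitionLength (lam : YoungDiagram) : ℕ := lam.colLen 0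

/-- `λ`-plane trees: plane trees with labels in `{1, …, ℓ(λ)}` (here shifted to `{0, …, ℓ(λ) - 1}`,
in accordance with the indexing of the boxes of a `YoungDiagram` from `0`) such that the labels
`x`, `y` of the ends of each edge satisfy `(x, y) ∈ λ`. The notion is used for `λ` self-conjugate, so
that it does not matter which end of the edge comes first. -/
def IsLambdaPlaneTree (lam : YoungDiagram)
    (T : LabelledPlaneTree (Fin (partitionLength lam))) : Prop :=
  T.EdgesSatisfy fun x y : Fin (partitionLength lam) => ((x : ℕ), (y : ℕ)) ∈ lam

/-- `C_k^λ`, the number of `λ`-plane trees on `k + 1` vertices. -/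
noncomputable def numLambdaPlaneTrees (lam : YoungDiagram) (k : ℕ) : ℕ :=
  Nat.card {T : LabelledPlaneTree (Fin (partitionLength lam)) //
    T.numVertices = k + 1 ∧ IsLambdaPlaneTree lam T}

/-- The list of parts `(b₁, …, b₁, b₂, …, b₂, …, bᵣ, …, bᵣ)`, where `bᵢ` is repeated `aᵢ` times. -/
def multirectangularParts {r : ℕ} (a b : Fin r → ℕ) : List ℕ :=
  (List.ofFn fun i => List.replicate (a i) (b i)).flatten

/-- `λ = a × b` in multirectangular coordinates: `a` and `b` are lists of positive integers, `b` is
strictly decreasing, and the nonzero parts of `λ` are `b₁ ^ a₁, …, bᵣ ^ aᵣ`. -/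
structure IsMultirectangular (lam : YoungDiagram) {r : ℕ} (a b : Fin r → ℕ) : Prop where
  heights_pos : ∀ i, 0 < a i
  bases_pos : ∀ i, 0 < b i
  bases_strictAnti : StrictAnti b
  parts_eq : lam.rowLens = multirectangularParts a b

/-- `x_{≤ i} = x₁ + ⋯ + xᵢ`. -/
def sumLE {r : ℕ} (x : Fin r → ℕ) (i : Fin r) : ℕ := ∑ j with j ≤ i, x j

/-- `x_{≥ i} = xᵢ + ⋯ + xᵣ`. -/
def sumGE {r : ℕ} (x : Fin r → ℕ) (i : Fin r) : ℕ := ∑ j with i ≤ j, x j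

/-- The coefficient
`t(l₁, …, lᵣ) = (1 / k) ∏ⱼ binom(l_{≥ j} + l_{≤ r - j + 1} - 1 - 1_{j ≤ ⌈r/2⌉}, lⱼ)`.
The element `j : Fin r` stands for the index `j + 1`; then `j.rev` stands for `r - (j + 1) + 1`.
The upper entry of the binomial coefficient is an integer, which can be `-1` if `lⱼ = 0`. -/
noncomputable def treeCoeff {r : ℕ} (k : ℕ) (l : Fin r → ℕ) : ℚ :=
  1 / (k : ℚ) * ∏ j : Fin r,
    ((Ring.choose ((sumGE l j : ℤ) + (sumLE l j.rev : ℤ) - 1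
      - (if (j : ℕ) + 1 ≤ (r + 1) / 2 then 1 else 0)) (l j) : ℤ) : ℚ)

/-! Let `f_y` count trees with root label `y` by vertices. Splitting off the first subtree of the
root gives `f_y * (1 - ∑_{z < λ_y} f_z) = X`. Put `U_i = 1 - ∑ f_y`, summed over the first `i`
blocks of labels. Self-conjugacy makes every row length a block boundary, so summing over block `i`
(counted from 0) gives the closed system `(U_i - U_{i+1}) * U_{r-i} = a_i X` with `U_0 = 1`, and
`C_k` is minus the coefficient of `X^(k+1)` in `U_r`.

Order the unknowns in a zigzag `u = U_0, U_r, U_1, U_{r-1}, …`. By the system, consecutive products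
`u_s u_{s+1}` differ by `± a_j X`, so with `w = X / U_r` each quotient `u_s u_{s+1} / U_r` is a
linear polynomial `1 + c w`. The zigzag meets itself in the middle (`u_r = u_{r+1}`), so an
alternating product of powers of these quotients telescopes to `U_r^(-k)` (`map_alternatingProd`).
Thus `U_r^(-k) = F(w)` with `F` an explicit product of powers of linear polynomials.

Lagrange inversion (`coeff_eq_of_subst_mul_pow_eq_one`) identifies `k C_k` with the coefficient of
`X^(k+1)` in `F`. Iterated binomial expansion (`coeff_alternatingProd`) turns it into a sum of
products of binomials, which `choose_zigzagEquiv` matches with `treeCoeff`. -/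

open Finset

/-! ### Powers of linear series and their alternating products -/

namespace PowerSeries

/-- The power series `(1 + c X) ^ e`. -/
noncomputable def linearPow (c : ℚ) (e : ℤ) : ℚ⟦X⟧ :=
  mk fun n => ((Ring.choose e n : ℤ) : ℚ) * c ^ n

lemma linearPow_eq_rescale (c : ℚ) (e : ℤ) :
    linearPow c e = rescale c (binomialSeries ℚ e) := by
  ext n
  simp [linearPow, coeff_rescale, mul_comm]

lemma linearPow_add (c : ℚ) (e f : ℤ) :
    linearPow c (e + f) = linearPow c e * linearPow c f := by
  simp [linearPow_eq_rescale]

lemma linearPow_zero_right (c : ℚ) : linearPow c 0 = 1 := by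
  simp [linearPow_eq_rescale]

lemma linearPow_zero_left (e : ℤ) : linearPow 0 e = 1 := by
  ext n
  rcases n with _ | n <;> simp [linearPow, coeff_one]

lemma linearPow_one (c : ℚ) : linearPow c 1 = 1 + C c * X := by
  have := binomialSeries_nat (R := ℤ) (A := ℚ) 1
  rw [linearPow_eq_rescale, ← Nat.cast_one, this]
  simp [rescale_X]

/-- Coefficient form of the expansion of `(1 + (β + c) X) ^ e` in powers of `β X`. -/
lemma coeff_linearPow_add (β c : ℚ) (e : ℤ) (n : ℕ) :
    coeff n (linearPow (β + c) e) = ∑ p ∈ antidiagonal n,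
      ((Ring.choose e p.1 : ℤ) : ℚ) * β ^ p.1 * coeff p.2 (linearPow c (e - p.1)) := by
  simp only [linearPow, coeff_mk, mul_sum, (Commute.all β c).add_pow']
  refine sum_congr rfl fun p hp => ?_
  obtain rfl := HasAntidiagonal.mem_antidiagonal.mp hp
  have h := Ring.choose_smul_choose e (Nat.le_add_right p.1 p.2)
  rw [Nat.add_sub_cancel_left] at h
  have h' : ((p.1 + p.2).choose p.1 : ℚ) * ((Ring.choose e (p.1 + p.2) : ℤ) : ℚ) =
      ((Ring.choose e p.1 : ℤ) : ℚ) * ((Ring.choose (e - p.1) p.2 : ℤ) : ℚ) := by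
    rw [nsmul_eq_mul] at h
    exact_mod_cast h
  rw [nsmul_eq_mul]
  linear_combination (β ^ p.1 * c ^ p.2) * h'

lemma coeff_linearPow_add_mul (β c : ℚ) (e : ℤ) (f : ℚ⟦X⟧) (n : ℕ) :
    coeff n (linearPow (β + c) e * f) = ∑ p ∈ antidiagonal n,
      ((Ring.choose e p.1 : ℤ) : ℚ) * β ^ p.1 * coeff p.2 (linearPow c (e - p.1) * f) := by
  simp only [coeff_mul, coeff_linearPow_add, sum_mul, mul_sum]
  rw [sum_sigma', sum_sigma']
  refine sum_bij' (fun x _ => ⟨(x.2.1, x.2.2 + x.1.2), (x.2.2, x.1.2)⟩)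
    (fun x _ => ⟨(x.1.1 + x.2.1, x.2.2), (x.1.1, x.2.1)⟩) ?_ ?_ ?_ ?_ ?_
  · rintro ⟨⟨a, b⟩, ⟨c, d⟩⟩ h
    simp only [mem_sigma, HasAntidiagonal.mem_antidiagonal] at h ⊢
    exact ⟨by omega, trivial⟩
  · rintro ⟨⟨a, b⟩, ⟨c, d⟩⟩ h
    simp only [mem_sigma, HasAntidiagonal.mem_antidiagonal] at h ⊢
    exact ⟨by omega, trivial⟩
  · rintro ⟨⟨a, b⟩, ⟨c, d⟩⟩ h
    simp only [mem_sigma, HasAntidiagonal.mem_antidiagonal] at h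
    obtain ⟨_, rfl⟩ := h
    rfl
  · rintro ⟨⟨a, b⟩, ⟨c, d⟩⟩ h
    simp only [mem_sigma, HasAntidiagonal.mem_antidiagonal] at h
    obtain ⟨_, rfl⟩ := h
    rfl
  · rintro ⟨⟨a, b⟩, ⟨c, d⟩⟩ h
    simp [mul_assoc]

/-- With `qₛ = 1 + (βₛ + ⋯ + βₙ₋₁) X`, the series
`q₀ ^ κ * q₁ ^ (-2κ) * q₂ ^ (2κ) * ⋯`. -/
noncomputable def alternatingProd : ∀ n : ℕ, (Fin n → ℚ) → ℤ → ℚ⟦X⟧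
  | 0, _, _ => 1
  | n + 1, β, κ => linearPow (∑ i, β i) κ * linearPow (∑ i, Fin.tail β i) (-κ) *
      alternatingProd n (Fin.tail β) (-κ)

lemma sum_antidiagonalTuple_succ {M : Type*} [AddCommMonoid M] (n N : ℕ)
    (f : (Fin (n + 1) → ℕ) → M) :
    ∑ l ∈ Nat.antidiagonalTuple (n + 1) N, f l =
      ∑ p ∈ antidiagonal N, ∑ l ∈ Nat.antidiagonalTuple n p.2, f (Fin.cons p.1 l) := by
  rw [sum_sigma']
  refine sum_bij' (fun l _ => ⟨(l 0, ∑ i, Fin.tail l i), Fin.tail l⟩)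
    (fun x _ => Fin.cons x.1.1 x.2) ?_ ?_ ?_ ?_ ?_
  · intro l hl
    simp only [Nat.mem_antidiagonalTuple, Fin.sum_univ_succ] at hl
    simpa [Nat.mem_antidiagonalTuple, Fin.tail] using hl
  · rintro ⟨p, l⟩ h
    simp only [mem_sigma, HasAntidiagonal.mem_antidiagonal, Nat.mem_antidiagonalTuple] at h
    simp [Nat.mem_antidiagonalTuple, Fin.sum_univ_succ, h.2, h.1]
  · intro l _
    simp
  · rintro ⟨⟨a, b⟩, l⟩ h
    simp only [mem_sigma, HasAntidiagonal.mem_antidiagonal, Nat.mem_antidiagonalTuple] at h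
    obtain ⟨_, rfl⟩ := h
    simp
  · intro l _
    simp

/-- Expand the outermost factor in powers of `β 0 * X`: choosing the exponent `p` leaves a power of
the next linear factor whose exponent is lowered by `p`. The extra factor with exponent `-M` makes
the induction close, `M` recording the exponents already chosen. -/
theorem coeff_alternatingProd (n N : ℕ) (β : Fin n → ℚ) (κ M : ℤ) :
    coeff N (linearPow (∑ i, β i) (-M) * alternatingProd n β κ) =
      ∑ l ∈ Nat.antidiagonalTuple n N, ∏ s : Fin n,
        ((Ring.choose ((-1) ^ (s : ℕ) * κ - M - ∑ t with t < s, (l t : ℤ)) (l s) : ℤ) : ℚ) *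
          β s ^ l s := by
  induction n generalizing N κ M with
  | zero =>
    rcases N with _ | N <;> simp [alternatingProd, linearPow_zero_left, coeff_one]
  | succ n ih =>
    rw [sum_antidiagonalTuple_succ]
    have h1 : linearPow (∑ i, β i) (-M) * alternatingProd (n + 1) β κ =
        linearPow (β 0 + ∑ i, Fin.tail β i) (κ - M) *
          (linearPow (∑ i, Fin.tail β i) (-κ) * alternatingProd n (Fin.tail β) (-κ)) := by
      have : ∑ i, β i = β 0 + ∑ i, Fin.tail β i := Fin.sum_univ_succ β
      rw [alternatingProd, this, sub_eq_neg_add, linearPow_add]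
      ring
    rw [h1, coeff_linearPow_add_mul]
    refine sum_congr rfl fun p _ => ?_
    rw [← mul_assoc, ← linearPow_add,
      show κ - M - (p.1 : ℤ) + -κ = -(M + p.1) by ring, ih, mul_sum]
    refine sum_congr rfl fun l _ => ?_
    rw [Fin.prod_univ_succ]
    congr 1
    · simp
    · refine prod_congr rfl fun s _ => ?_
      have h2 : ∑ t : Fin (n + 1) with t < s.succ, ((Fin.cons p.1 l : Fin (n + 1) → ℕ) t : ℤ) =
          p.1 + ∑ t with t < s, (l t : ℤ) := by
        simp [sum_filter, Fin.sum_univ_succ]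
      rw [h2]
      simp only [Fin.cons_succ, Fin.val_succ, Fin.tail]
      have h3 : (-1) ^ (s : ℕ) * -κ - (M + p.1) - ∑ t with t < s, (l t : ℤ) =
          (-1) ^ ((s : ℕ) + 1) * κ - M - (p.1 + ∑ t with t < s, (l t : ℤ)) := by
        ring
      rw [h3]

lemma map_linearPow {K : Type*} [Field K] (ψ : ℚ⟦X⟧ →+* K) (c : ℚ) (e : ℤ) :
    ψ (linearPow c e) = ψ (linearPow c 1) ^ e := by
  have h0 : ψ (linearPow c 1) ≠ 0 := by
    intro h
    have := congrArg ψ (linearPow_add c 1 (-1))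
    rw [map_mul, h, add_neg_cancel, linearPow_zero_right, map_one, zero_mul] at this
    exact one_ne_zero this
  induction e using Int.induction_on with
  | zero => simp [linearPow_zero_right]
  | succ i ih => rw [linearPow_add, map_mul, ih, zpow_add_one₀ h0]
  | pred i ih =>
    rw [zpow_sub_one₀ h0, ← ih, eq_mul_inv_iff_mul_eq₀ h0, ← map_mul, ← linearPow_add,
      sub_add_cancel]

/-- If the linear factors `qₛ` of `alternatingProd` become `vₛ vₛ₊₁ / y` in a field, the product
telescopes. -/
theorem map_alternatingProd {K : Type*} [Field K] (ψ : ℚ⟦X⟧ →+* K) (y : K) (hy : y ≠ 0)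
    (n : ℕ) (β : Fin n → ℚ) (κ : ℤ) (v : ℕ → K) (hv : ∀ s ≤ n + 1, v s ≠ 0)
    (h : ∀ s ≤ n, ψ (linearPow (∑ i with s ≤ Fin.val i, β i) 1) = v s * v (s + 1) / y) :
    ψ (alternatingProd n β κ) = (v 0 / v 1) ^ κ * (v (n + 1) ^ 2 / y) ^ ((-1) ^ n * κ) := by
  induction n generalizing κ v with
  | zero =>
    have h0 := h 0 le_rfl
    have h1 := hv 1 le_rfl
    -- The innermost linear factor has an empty sum, hence equals 1, which forces `v 0 * v 1 = y`.
    simp only [univ_eq_empty, filter_empty, sum_empty, linearPow_zero_left, map_one] at h0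
    rw [alternatingProd, map_one, pow_zero, one_mul, ← mul_zpow]
    have : v 0 / v 1 * (v (0 + 1) ^ 2 / y) = 1 := by
      rw [h0, zero_add]
      field_simp
    rw [this, one_zpow]
  | succ n ih =>
    have hsum : ∀ s, ∑ i with s ≤ Fin.val i, Fin.tail β i =
        ∑ i with s + 1 ≤ Fin.val i, β i := by
      intro s
      simp [sum_filter, Fin.sum_univ_succ, Fin.tail]
    have ih' := ih (Fin.tail β) (-κ) (fun s => v (s + 1)) (fun s hs => hv _ (by omega))
      (fun s hs => by rw [hsum]; exact h (s + 1) (by omega))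
    have h0 := h 0 (by omega)
    have h1 := h 1 (by omega)
    rw [← hsum 0] at h1
    simp only [zero_le, filter_true] at h0 h1
    have hv0 := hv 0 (by omega)
    have hv1 := hv 1 (by omega)
    have hv2 := hv 2 (by omega)
    rw [alternatingProd, map_mul, map_mul, ih', map_linearPow, map_linearPow ψ _ (-κ), h0, h1,
      show (-1 : ℤ) ^ n * -κ = (-1) ^ (n + 1) * κ by ring, ← mul_assoc]
    congr 1
    simp only [zpow_neg, ← inv_zpow, ← mul_zpow]
    congr 1
    simp only [zero_add]
    field_simp

end PowerSeries
-- Lagrange inversion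
namespace PowerSeries

/-- Up to the factor `M + 1`, the series is `(M + 1) * V - X * V'` with `V = U ^ (M + 1)`. The
operator `X * d/dX` multiplies the coefficient of `X ^ n` by `n`, so the two terms cancel at `n = M
+ 1`. -/
lemma coeff_pow_sub_X_mul_derivative (U : ℚ⟦X⟧) (M : ℕ) :
    coeff (M + 1) (U ^ M * (U - X * d⁄dX ℚ U)) = 0 := by
  have h : C ((M : ℚ) + 1) * (U ^ M * (U - X * d⁄dX ℚ U)) =
      C ((M : ℚ) + 1) * U ^ (M + 1) - X * d⁄dX ℚ (U ^ (M + 1)) := by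
    rw [derivative_pow]
    simp only [map_add, map_natCast, map_one, Nat.cast_add, Nat.cast_one, Nat.add_sub_cancel]
    ring
  have h2 := congrArg (coeff (M + 1)) h
  rw [coeff_C_mul, map_sub, coeff_C_mul, coeff_succ_X_mul, coeff_derivative] at h2
  have hM : (M : ℚ) + 1 ≠ 0 := by positivity
  refine (mul_eq_zero.mp (h2.trans ?_)).resolve_left hM
  ring

/-- A form of the Lagrange inversion formula: `w = X / U` and `f(w) = U ^ (-k)`. -/
theorem coeff_eq_of_subst_mul_pow_eq_one (U w f : ℚ⟦X⟧) (k : ℕ)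
    (hU : constantCoeff U = 1) (hw : w * U = X) (hf : f.subst w * U ^ k = 1) :
    coeff (k + 1) f = -(k * coeff (k + 1) U) := by
  have hw0 : constantCoeff w = 0 := by
    have := congrArg constantCoeff hw
    simpa [hU] using this
  have hs : HasSubst w := HasSubst.of_constantCoeff_zero' hw0
  set Q := U - X * d⁄dX ℚ U with hQ
  have hQ0 : constantCoeff Q = 1 := by simp [hQ, hU]
  obtain ⟨V, hUV⟩ : ∃ V, U * V = 1 := ⟨U⁻¹, PowerSeries.mul_inv_cancel U (by simp [hU])⟩
  have hV0 : constantCoeff V = 1 := by simpa [hU] using congrArg constantCoeff hUV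
  have hwV : w = X * V := by rw [← hw, mul_assoc, hUV, mul_one]
  -- split off the tail of `f`
  obtain ⟨g, hg⟩ : ∃ g, f = (trunc (k + 2) f : ℚ⟦X⟧) + X ^ (k + 2) * g := by
    have : (X : ℚ⟦X⟧) ^ (k + 2) ∣ f - (trunc (k + 2) f : ℚ⟦X⟧) := by
      rw [X_pow_dvd_iff]
      intro m hm
      simp [coeff_trunc, hm]
    obtain ⟨g, hg⟩ := this
    exact ⟨g, by rw [← hg]; ring⟩
  have hsub : f.subst w = ∑ j ∈ range (k + 2), C (coeff j f) * w ^ j +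
      w ^ (k + 2) * g.subst w := by
    conv_lhs => rw [hg]
    rw [subst_add hs, subst_mul hs, subst_pow hs, subst_X hs, subst_coe hs,
      Polynomial.aeval_eq_sum_range' (n := k + 2) (natDegree_trunc_lt f (k + 1))]
    congr 1
    refine sum_congr rfl fun j hj => ?_
    rw [coeff_trunc, if_pos (mem_range.mp hj), smul_eq_C_mul]
  -- The factor `Q` plays the role of the Jacobian of `w`. Since `w ^ j * U ^ k * Q = X ^ j * U ^ (k
  -- - j) * Q`, the preceding lemma kills the terms with `j ≤ k`, the terms beyond `k + 1` have too
  -- high an order, and `j = k + 1` contributes exactly the coefficient of `f`.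
  have h1 : coeff (k + 1) (f.subst w * U ^ k * Q) = -(k * coeff (k + 1) U) := by
    rw [hf, one_mul, hQ, map_sub, coeff_succ_X_mul, coeff_derivative]
    ring
  rw [← h1, hsub, add_mul, add_mul, map_add, sum_mul, sum_mul, map_sum, sum_range_succ,
    sum_eq_zero, zero_add]
  · have e1 : C (coeff (k + 1) f) * w ^ (k + 1) * U ^ k * Q =
        C (coeff (k + 1) f) * (X ^ (k + 1) * (V * Q)) := by
      have : V ^ k * U ^ k = 1 := by rw [← mul_pow, mul_comm, hUV, one_pow]
      rw [hwV]
      linear_combination C (coeff (k + 1) f) * X ^ (k + 1) * V * Q * this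
    have e2 : w ^ (k + 2) * g.subst w * U ^ k * Q =
        X ^ (k + 2) * (V ^ (k + 2) * g.subst w * U ^ k * Q) := by
      rw [hwV]; ring
    rw [e1, e2, coeff_C_mul, coeff_X_pow_mul', coeff_X_pow_mul', if_pos le_rfl,
      if_neg (by omega)]
    simp [hV0, hQ0]
  · intro j hj
    obtain ⟨M, rfl⟩ := Nat.exists_eq_add_of_le (Nat.lt_succ_iff.mp (mem_range.mp hj))
    have e1 : C (coeff j f) * w ^ j * U ^ (j + M) * Q =
        C (coeff j f) * (X ^ j * (U ^ M * Q)) := by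
      have : V ^ j * U ^ j = 1 := by rw [← mul_pow, mul_comm, hUV, one_pow]
      rw [hwV]
      linear_combination C (coeff j f) * X ^ j * U ^ M * Q * this
    rw [e1, coeff_C_mul, coeff_X_pow_mul', if_pos (by omega),
      show j + M + 1 - j = M + 1 by omega, coeff_pow_sub_X_mul_derivative, mul_zero]

end PowerSeries

/-! ### Recursive decomposition and counting of labelled trees -/

namespace LabelledPlaneTree

variable {α : Type}

/-- The trees with `n` vertices and root label `x` all of whose edges satisfy `R`. -/
def treesWithRoot (R : α → α → Prop) (x : α) (n : ℕ) : Set (LabelledPlaneTree α) :=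
  {t | t.rootLabel = x ∧ t.numVertices = n ∧ t.EdgesSatisfy R}

/-- The lists of trees with `n` vertices in total that can be attached to a root labelled `x`. -/
def forestsBelow (R : α → α → Prop) (x : α) (n : ℕ) : Set (List (LabelledPlaneTree α)) :=
  {ts | (ts.map numVertices).sum = n ∧ ∀ t ∈ ts, R x t.rootLabel ∧ t.EdgesSatisfy R}

lemma numVertices_node (x : α) (ts : List (LabelledPlaneTree α)) :
    (node x ts).numVertices = 1 + (ts.map numVertices).sum := by
  rw [numVertices]

lemma numVertices_pos (t : LabelledPlaneTree α) : 0 < t.numVertices := by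
  cases t
  rw [numVertices_node]
  omega

lemma edgesSatisfy_node_iff {R : α → α → Prop} {x : α} {ts : List (LabelledPlaneTree α)} :
    (node x ts).EdgesSatisfy R ↔ ∀ t ∈ ts, R x t.rootLabel ∧ t.EdgesSatisfy R := by
  constructor
  · rintro ⟨⟩
    rename_i h2 h1
    exact fun t ht => ⟨h1 t ht, h2 t ht⟩
  · exact fun h => .node x ts (fun t ht => (h t ht).1) (fun t ht => (h t ht).2)

/-- Attaching a forest to a root is a bijection. -/
noncomputable def forestsBelowEquiv (R : α → α → Prop) (x : α) (n : ℕ) :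
    forestsBelow R x n ≃ treesWithRoot R x (n + 1) :=
  Equiv.ofBijective
    (fun ts => ⟨node x ts.1, rfl, by rw [numVertices_node, ts.2.1, add_comm],
      edgesSatisfy_node_iff.mpr ts.2.2⟩) <| by
    constructor
    · rintro ⟨ts, _⟩ ⟨ts', _⟩ h
      have := congrArg Subtype.val h
      simpa using this
    · rintro ⟨⟨y, ts⟩, h1, h2, h3⟩
      obtain rfl : y = x := h1
      rw [numVertices_node] at h2
      exact ⟨⟨ts, by omega, edgesSatisfy_node_iff.mp h3⟩, rfl⟩

/-- A nonempty forest is a tree followed by a forest. -/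
noncomputable def consEquiv (R : α → α → Prop) (x : α) (n : ℕ) :
    (Σ p : antidiagonal n,
      (Σ y : {y // R x y}, treesWithRoot R y.1 (p.1.1 + 1)) × forestsBelow R x p.1.2) ≃
      forestsBelow R x (n + 1) :=
  Equiv.ofBijective
    (fun q => ⟨q.2.1.2.1 :: q.2.2.1, by
      obtain ⟨⟨⟨i, j⟩, hp⟩, ⟨⟨⟨y, hy⟩, ⟨t, ht1, ht2, ht3⟩⟩, ⟨ts, hts1, hts2⟩⟩⟩ := q
      rw [HasAntidiagonal.mem_antidiagonal] at hp
      dsimp only at hp ht1 ht2 hts1 hy ⊢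
      refine ⟨?_, ?_⟩
      · rw [List.map_cons, List.sum_cons, ht2, hts1]
        omega
      · intro t' h'
        rcases List.mem_cons.mp h' with rfl | h'
        · exact ⟨ht1 ▸ hy, ht3⟩
        · exact hts2 t' h'⟩) <| by
    constructor
    · rintro ⟨⟨⟨i, j⟩, hp⟩, ⟨⟨⟨y, hy⟩, ⟨t, ht1, ht2, ht3⟩⟩, ⟨ts, hts1, hts2⟩⟩⟩
        ⟨⟨⟨i', j'⟩, hp'⟩, ⟨⟨⟨y', hy'⟩, ⟨t', ht1', ht2', ht3'⟩⟩, ⟨ts', hts1', hts2'⟩⟩⟩ h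
      simp only [Subtype.mk.injEq, List.cons.injEq] at h
      obtain ⟨rfl, rfl⟩ := h
      dsimp only at ht1 ht2 hts1 ht1' ht2' hts1'
      subst ht1 ht1' hts1 hts1'
      obtain rfl : i = i' := by omega
      rfl
    · rintro ⟨ts, h1, h2⟩
      rcases ts with _ | ⟨t, ts⟩
      · simp at h1
      · rw [List.map_cons, List.sum_cons] at h1
        have ht := numVertices_pos t
        refine ⟨⟨⟨(t.numVertices - 1, (ts.map numVertices).sum), ?_⟩,
          ⟨⟨t.rootLabel, (h2 t (by simp)).1⟩, ⟨t, rfl, ?_, (h2 t (by simp)).2⟩⟩,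
          ⟨ts, rfl, fun t' h' => h2 t' (by simp [h'])⟩⟩, rfl⟩
        · rw [HasAntidiagonal.mem_antidiagonal]
          dsimp only
          omega
        · dsimp only
          omega

lemma forestsBelow_zero (R : α → α → Prop) (x : α) : forestsBelow R x 0 = {[]} := by
  ext ts
  rcases ts with _ | ⟨t, ts⟩
  · simp [forestsBelow]
  · have := numVertices_pos t
    simp only [forestsBelow, List.map_cons, List.sum_cons, Set.mem_ofPred_eq,
      Set.mem_singleton_iff, reduceCtorEq, iff_false]
    omega

/-- Needed because `Nat.card` is 0 on infinite types: the counting formulas for sums of types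
require finite summands. -/
lemma finite_forestsBelow [Finite α] (R : α → α → Prop) (x : α) (n : ℕ) :
    Finite (forestsBelow R x n) := by
  induction n using Nat.strong_induction_on generalizing x with
  | _ n ih =>
    rcases n with _ | n
    · rw [forestsBelow_zero]
      infer_instance
    · have h (p : antidiagonal n) : p.1.1 < n + 1 ∧ p.1.2 < n + 1 := by
        have := HasAntidiagonal.mem_antidiagonal.mp p.2
        omega
      have h1 (p : antidiagonal n) (y : α) : Finite (treesWithRoot R y (p.1.1 + 1)) :=
        have := ih _ (h p).1 y
        .of_equiv _ (forestsBelowEquiv R y _)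
      have h2 (p : antidiagonal n) : Finite (forestsBelow R x p.1.2) := ih _ (h p).2 x
      exact .of_equiv _ (consEquiv R x n)

lemma finite_treesWithRoot [Finite α] (R : α → α → Prop) (x : α) (n : ℕ) :
    Finite (treesWithRoot R x (n + 1)) :=
  have := finite_forestsBelow R x n
  .of_equiv _ (forestsBelowEquiv R x n)

lemma card_treesWithRoot_succ [Fintype α] (R : α → α → Prop) [DecidableRel R] (x : α) (n : ℕ) :
    Nat.card (treesWithRoot R x (n + 1 + 1)) = ∑ p ∈ antidiagonal n,
      (∑ y with R x y, Nat.card (treesWithRoot R y (p.1 + 1))) *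
        Nat.card (treesWithRoot R x (p.2 + 1)) := by
  have h1 := finite_treesWithRoot R
  have h2 := finite_forestsBelow R
  rw [← Nat.card_congr (forestsBelowEquiv R x (n + 1)), ← Nat.card_congr (consEquiv R x n),
    Nat.card_sigma, ← Finset.sum_coe_sort (antidiagonal n)]
  refine Finset.sum_congr rfl fun p _ => ?_
  rw [Nat.card_prod, Nat.card_sigma, Nat.card_congr (forestsBelowEquiv R x p.1.2)]
  congr 1
  exact (Finset.sum_subtype _ (by simp) fun y => Nat.card (treesWithRoot R y (p.1.1 + 1))).symm

lemma card_treesWithRoot_one (R : α → α → Prop) (x : α) :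
    Nat.card (treesWithRoot R x 1) = 1 := by
  rw [← Nat.card_congr (forestsBelowEquiv R x 0), forestsBelow_zero]
  simp

/-- The number of trees is the sum over the root labels. -/
lemma card_trees [Fintype α] (R : α → α → Prop) (n : ℕ) :
    Nat.card {t : LabelledPlaneTree α // t.numVertices = n + 1 ∧ t.EdgesSatisfy R} =
      ∑ x, Nat.card (treesWithRoot R x (n + 1)) := by
  have h1 := finite_treesWithRoot R
  rw [← Nat.card_sigma]
  refine (Nat.card_congr (Equiv.ofBijective
    (fun q : Σ x, treesWithRoot R x (n + 1) => ⟨q.2.1, q.2.2.2⟩) ⟨?_, ?_⟩)).symm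
  · rintro ⟨x, t, rfl, h⟩ ⟨x', t', rfl, h'⟩ ht
    simp only [Subtype.mk.injEq] at ht
    subst ht
    rfl
  · rintro ⟨t, h⟩
    exact ⟨⟨t.rootLabel, t, rfl, h⟩, rfl⟩

/-- The generating function of trees with root label `x`, by number of non-root vertices. -/
noncomputable def rootSeries (R : α → α → Prop) (x : α) : PowerSeries ℚ :=
  .mk fun n => (Nat.card (treesWithRoot R x (n + 1)) : ℚ)

open PowerSeries in
lemma rootSeries_eq [Fintype α] (R : α → α → Prop) [DecidableRel R] (x : α) :
    rootSeries R x * (1 - X * ∑ y with R x y, rootSeries R y) = 1 := by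
  have h : rootSeries R x =
      1 + X * ((∑ y with R x y, rootSeries R y) * rootSeries R x) := by
    ext n
    rcases n with _ | n
    · rw [rootSeries, coeff_mk, card_treesWithRoot_one]
      simp
    · rw [map_add, coeff_succ_X_mul, coeff_mul, coeff_one, if_neg n.succ_ne_zero, zero_add]
      simp only [rootSeries, coeff_mk, map_sum, card_treesWithRoot_succ]
      push_cast
      rfl
  linear_combination h

end LabelledPlaneTree

/-! ### Self-conjugate diagrams in multirectangular coordinates -/

lemma List.countP_range_lt (n c : ℕ) : (List.range n).countP (fun x => x < c) = min n c := by
  induction n with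
  | zero => simp
  | succ n ih =>
    rw [List.range_succ, List.countP_append, ih, List.countP_singleton]
    by_cases h : n < c <;> simp [h] <;> omega

lemma YoungDiagram.colLen_eq_countP (μ : YoungDiagram) (y : ℕ) :
    μ.colLen y = μ.rowLens.countP (fun l => y < l) := by
  have h : (fun l : ℕ => decide (y < l)) ∘ μ.rowLen = fun x => decide (x < μ.colLen y) := by
    funext x
    simp [← mem_iff_lt_rowLen, ← mem_iff_lt_colLen]
  rw [rowLens, List.countP_map, h, List.countP_range_lt, min_eq_right]
  exact μ.colLen_anti 0 y zero_le

section Prefix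

variable {r : ℕ}

/-- `x₁ + ⋯ + xᵢ`, where `i` may be any natural number. -/
def prefixSum (a : Fin r → ℕ) (i : ℕ) : ℕ := ∑ j with Fin.val j < i, a j

lemma sumLE_eq_prefixSum (a : Fin r → ℕ) (i : Fin r) : sumLE a i = prefixSum a (i + 1) := by
  simp only [sumLE, prefixSum, Fin.le_def, Nat.lt_succ_iff]

lemma prefixSum_zero (a : Fin r → ℕ) : prefixSum a 0 = 0 := by
  simp [prefixSum]

lemma prefixSum_self (a : Fin r → ℕ) : prefixSum a r = ∑ i, a i := by
  simp [prefixSum]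

lemma prefixSum_mono (a : Fin r → ℕ) : Monotone (prefixSum a) := fun i j h =>
  sum_le_sum_of_subset fun x hx => by
    simp only [mem_filter, mem_univ, true_and] at hx ⊢
    omega

lemma prefixSum_succ (a : Fin r → ℕ) (i : Fin r) :
    prefixSum a (i + 1) = prefixSum a i + a i := by
  have h : ({j | Fin.val j < (i : ℕ) + 1} : Finset (Fin r)) =
      insert i ({j | Fin.val j < (i : ℕ)} : Finset (Fin r)) := by
    ext j
    simp only [mem_filter, mem_univ, true_and, mem_insert, Fin.ext_iff]
    omega
  rw [prefixSum, h, sum_insert (by simp), add_comm, prefixSum]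

end Prefix

lemma countP_multirectangularParts {r : ℕ} (a b : Fin r → ℕ) (p : ℕ → Bool) :
    (multirectangularParts a b).countP p = ∑ i with p (b i), a i := by
  rw [multirectangularParts, List.countP_flatten, List.map_ofFn, List.sum_ofFn, sum_filter]
  refine sum_congr rfl fun i _ => ?_
  simp [List.countP_replicate]

lemma StrictAnti.eq_rev {r : ℕ} {f : Fin r → Fin r} (hf : StrictAnti f) : f = Fin.rev := by
  have h : Fin.rev ∘ f = id := (Fin.rev_strictAnti.comp hf).eq_id
  funext i
  rw [← Fin.rev_rev (f i)]
  exact congrArg Fin.rev (congrFun h i)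

namespace IsMultirectangular

variable {lam : YoungDiagram} {r : ℕ} {a b : Fin r → ℕ}

lemma rowLen_eq_sum (hlam : IsMultirectangular lam a b) (hconj : lam.transpose = lam) (y : ℕ) :
    lam.rowLen y = ∑ i with y < b i, a i := by
  rw [← YoungDiagram.colLen_transpose, hconj, YoungDiagram.colLen_eq_countP, hlam.parts_eq,
    countP_multirectangularParts]
  simp

/-- By conjugacy the number of parts that are at least `b i`, namely `sumLE a i`, is a row length,
hence some `b (f i)`. The map `f` is strictly decreasing on `Fin r`, so it is the reversal. -/
lemma base_eq (hlam : IsMultirectangular lam a b) (hconj : lam.transpose = lam) (i : Fin r) :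
    b i = sumLE a i.rev := by
  -- With columns numbered from 0, the boxes in column `b i - 1` belong to the rows of length at
  -- least `b i`.
  have h1 (i : Fin r) : lam.rowLen (b i - 1) = sumLE a i := by
    rw [hlam.rowLen_eq_sum hconj, sumLE]
    congr 1
    ext j
    have := hlam.bases_pos i
    simp only [mem_filter, mem_univ, true_and, ← hlam.bases_strictAnti.le_iff_ge]
    omega
  have hpos (i : Fin r) : 0 < sumLE a i := by
    rw [sumLE_eq_prefixSum, prefixSum_succ]
    have := hlam.heights_pos i
    omega
  have h2 (i : Fin r) : ∃ j, sumLE a i = b j := by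
    have hmem : lam.rowLen (b i - 1) ∈ lam.rowLens := by
      refine List.mem_map_of_mem (List.mem_range.mpr ?_)
      rw [← YoungDiagram.mem_iff_lt_colLen, YoungDiagram.mem_iff_lt_rowLen, h1]
      exact hpos i
    rw [hlam.parts_eq, h1] at hmem
    simp only [multirectangularParts, List.mem_flatten, List.mem_ofFn] at hmem
    obtain ⟨_, ⟨j, rfl⟩, hj⟩ := hmem
    exact ⟨j, List.eq_of_mem_replicate hj⟩
  choose f hf using h2
  have hanti : StrictAnti f := by
    intro i j hij
    rw [← hlam.bases_strictAnti.lt_iff_gt, ← hf, ← hf, sumLE_eq_prefixSum, sumLE_eq_prefixSum,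
      prefixSum_succ a j]
    have := prefixSum_mono a (show (i : ℕ) + 1 ≤ j from hij)
    have := hlam.heights_pos j
    omega
  rw [hf, hanti.eq_rev, Fin.rev_rev]

lemma partitionLength_eq (hlam : IsMultirectangular lam a b) (hconj : lam.transpose = lam) :
    partitionLength lam = prefixSum a r := by
  rw [partitionLength, ← YoungDiagram.rowLen_transpose, hconj, hlam.rowLen_eq_sum hconj,
    prefixSum_self]
  congr 1
  exact filter_true_of_mem fun i _ => hlam.bases_pos i

/-- Row lengths are constant on blocks and are themselves block boundaries, which is what closes the
system for the block series. -/
lemma rowLen_eq_prefixSum (hlam : IsMultirectangular lam a b) (hconj : lam.transpose = lam)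
    (i : Fin r) (y : ℕ) (h1 : prefixSum a i ≤ y) (h2 : y < prefixSum a (i + 1)) :
    lam.rowLen y = prefixSum a (r - i) := by
  rw [hlam.rowLen_eq_sum hconj, prefixSum]
  congr 1
  ext j
  simp only [mem_filter, mem_univ, true_and, hlam.base_eq hconj, sumLE_eq_prefixSum, Fin.val_rev]
  constructor
  · intro h
    by_contra! h'
    have := prefixSum_mono a (show r - ((j : ℕ) + 1) + 1 ≤ i by omega)
    omega
  · intro h
    have := prefixSum_mono a (show (i : ℕ) + 1 ≤ r - ((j : ℕ) + 1) + 1 by omega)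
    omega

end IsMultirectangular

/-! ### The zigzag order of the blocks -/

section Zigzag

/-- The order `middle, …, 2, r, 1` of the indices, read from the inside out. -/
def zigzagEquiv (r : ℕ) : Fin r ≃ Fin r where
  toFun s := ⟨if (r - 1 - s) % 2 = 0 then (r - 1 - s) / 2 else r - 1 - (r - 1 - s) / 2,
    by split_ifs <;> omega⟩
  invFun j := ⟨if 2 * (j : ℕ) < r then r - 1 - 2 * j else r - 1 - (2 * (r - 1 - j) + 1),
    by split_ifs <;> omega⟩
  left_inv s := by
    ext
    dsimp only
    split_ifs <;> omega
  right_inv j := by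
    ext
    dsimp only
    split_ifs <;> omega

variable {r : ℕ}

lemma zigzagEquiv_val (s : Fin r) : (zigzagEquiv r s : ℕ) =
    if (r - 1 - s) % 2 = 0 then (r - 1 - s) / 2 else r - 1 - (r - 1 - s) / 2 :=
  rfl

lemma zigzagEquiv_symm_val (j : Fin r) : ((zigzagEquiv r).symm j : ℕ) =
    if 2 * (j : ℕ) < r then r - 1 - 2 * j else r - 1 - (2 * (r - 1 - j) + 1) :=
  rfl

lemma sum_zigzagEquiv_lt (l : Fin r → ℕ) (s : Fin r) :
    ∑ t with t < s, l (zigzagEquiv r t) =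
      ∑ i, if ((zigzagEquiv r).symm i : ℕ) < s then l i else 0 := by
  rw [sum_filter, ← Equiv.sum_comp (zigzagEquiv r)
    (fun i => if ((zigzagEquiv r).symm i : ℕ) < s then l i else 0)]
  simp

/-- Here the indices at zigzag position `s` or later are the disjoint union of a final and an
initial segment, those of `sumGE` and `sumLE`. -/
lemma sum_zigzagEquiv_of_odd (l : Fin r → ℕ) (s : Fin r) (hs : (r - 1 - s) % 2 ≠ 0) :
    ∑ t with t < s, l (zigzagEquiv r t) + sumGE l (zigzagEquiv r s) +
      sumLE l (zigzagEquiv r s).rev = ∑ i, l i := by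
  rw [sum_zigzagEquiv_lt, sumGE, sumLE, sum_filter, sum_filter, ← sum_add_distrib,
    ← sum_add_distrib]
  refine sum_congr rfl fun i _ => ?_
  simp only [Fin.le_def, Fin.val_rev, zigzagEquiv_val, zigzagEquiv_symm_val, if_neg hs]
  have := s.2
  have := i.2
  split_ifs <;> omega

/-- Here the two segments cover all indices and overlap exactly in those at zigzag position at most
`s`. -/
lemma sum_zigzagEquiv_of_even (l : Fin r → ℕ) (s : Fin r) (hs : (r - 1 - s) % 2 = 0) :
    sumGE l (zigzagEquiv r s) + sumLE l (zigzagEquiv r s).rev =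
      ∑ i, l i + ∑ t with t < s, l (zigzagEquiv r t) + l (zigzagEquiv r s) := by
  have h : l (zigzagEquiv r s) = ∑ i, if i = zigzagEquiv r s then l i else 0 := by simp
  rw [sum_zigzagEquiv_lt, sumGE, sumLE, sum_filter, sum_filter, h, ← sum_add_distrib,
    ← sum_add_distrib, ← sum_add_distrib]
  refine sum_congr rfl fun i _ => ?_
  simp only [Fin.le_def, Fin.ext_iff, Fin.val_rev, zigzagEquiv_val, zigzagEquiv_symm_val, if_pos hs]
  have := s.2
  have := i.2
  split_ifs <;> omega

/-- The indices `j ≤ ⌈r/2⌉` are those occurring with a negative exponent. For them `binom(-m, n) =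
(-1)^n binom(m + n - 1, n)` absorbs the sign of the linear coefficient and produces the extra `-1`
in the upper entry. -/
lemma choose_zigzagEquiv (l : Fin r → ℕ) (k : ℕ) (hl : ∑ i, l i = k + 1) (s : Fin r) :
    ((Ring.choose ((-1) ^ (s : ℕ) * ((-1) ^ r * k) - 0 -
        ∑ t with t < s, (l (zigzagEquiv r t) : ℤ)) (l (zigzagEquiv r s)) : ℤ) : ℚ) *
      ((-1) ^ (r - s)) ^ l (zigzagEquiv r s) =
    ((Ring.choose ((sumGE l (zigzagEquiv r s) : ℤ) + (sumLE l (zigzagEquiv r s).rev : ℤ) - 1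
      - (if (zigzagEquiv r s : ℕ) + 1 ≤ (r + 1) / 2 then 1 else 0))
        (l (zigzagEquiv r s)) : ℤ) : ℚ) := by
  have hs2 := s.2
  have hsign : (-1 : ℤ) ^ (s : ℕ) * ((-1) ^ r * k) = (-1) ^ (r - s) * k := by
    obtain ⟨m, hm⟩ := Nat.exists_eq_add_of_lt hs2
    have h1 : (-1 : ℤ) ^ (s : ℕ) * (-1) ^ (s : ℕ) = 1 := by
      rw [← mul_pow]
      simp
    have h2 : (-1 : ℤ) ^ r = (-1) ^ (s : ℕ) * (-1) ^ (m + 1) := by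
      rw [← pow_add, ← add_assoc, ← hm]
    rw [show r - (s : ℕ) = m + 1 by omega, h2]
    linear_combination ((-1) ^ (m + 1) * k : ℤ) * h1
  rw [hsign, ← Nat.cast_sum]
  by_cases hs : (r - 1 - s) % 2 = 0
  · have h := sum_zigzagEquiv_of_even l s hs
    have hodd : Odd (r - (s : ℕ)) := by rw [Nat.odd_iff]; omega
    rw [if_pos (by rw [zigzagEquiv_val, if_pos hs]; omega), hodd.neg_one_pow, hodd.neg_one_pow]
    generalize l (zigzagEquiv r s) = n at h ⊢
    generalize ∑ t with t < s, l (zigzagEquiv r t) = M at h ⊢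
    rw [show (-1 : ℤ) * k - 0 - M = -(k + M) by ring, Ring.choose_neg]
    have h2 : (sumGE l (zigzagEquiv r s) : ℤ) + (sumLE l (zigzagEquiv r s).rev : ℤ) - 1 - 1 =
        k + M + n - 1 := by omega
    rw [h2, Units.smul_def, Int.coe_negOnePow_natCast, smul_eq_mul]
    push_cast
    rw [mul_right_comm, ← mul_pow]
    simp
  · have h := sum_zigzagEquiv_of_odd l s hs
    have heven : Even (r - (s : ℕ)) := by rw [Nat.even_iff]; omega
    rw [if_neg (by rw [zigzagEquiv_val, if_neg hs]; omega), heven.neg_one_pow, heven.neg_one_pow,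
      one_pow, mul_one]
    congr 2
    omega

end Zigzag

/-! ### Solving the system for the block series -/

namespace PowerSeries

/-- The coefficients of the last series of a system `(Uᵢ - Uᵢ₊₁) Uᵣ₋ᵢ = aᵢ X`, `U₀ = 1`. -/
theorem coeff_of_sub_mul_eq {r : ℕ} (a : Fin r → ℚ) (U : ℕ → ℚ⟦X⟧) (h0 : U 0 = 1)
    (hU : ∀ i, constantCoeff (U i) = 1)
    (h : ∀ i : Fin r, (U i - U (i + 1)) * U (r - i) = C (a i) * X) (k : ℕ) :
    k * coeff (k + 1) (U r) = -∑ l ∈ Finset.Nat.antidiagonalTuple r (k + 1), ∏ j : Fin r,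
      (((Ring.choose ((sumGE l j : ℤ) + (sumLE l j.rev : ℤ) - 1
        - (if (j : ℕ) + 1 ≤ (r + 1) / 2 then 1 else 0)) (l j) : ℤ) : ℚ) * a j ^ l j) := by
  -- These are the increments `± a_j` between consecutive zigzag products, listed from the middle
  -- outwards to match the nesting in `alternatingProd`.
  set β : Fin r → ℚ := fun s => (-1) ^ (r - s) * a (zigzagEquiv r s) with hβ
  let u : ℕ → ℚ⟦X⟧ := fun s => if s % 2 = 0 then U (s / 2) else U (r - s / 2)
  have hu (s : ℕ) : constantCoeff (u s) = 1 := by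
    dsimp only [u]
    split_ifs <;> exact hU _
  have hprod (s : ℕ) (hs : s ≤ r) :
      u s * u (s + 1) = U r + C (∑ i with r - s ≤ Fin.val i, β i) * X := by
    induction s with
    | zero =>
      have : ∑ i : Fin r with r - 0 ≤ Fin.val i, β i = 0 :=
        sum_eq_zero fun i hi => by
          simp only [mem_filter, mem_univ, true_and] at hi
          omega
      rw [this]
      simp [u, h0]
    | succ s ih =>
      have hins : ({i | r - (s + 1) ≤ Fin.val i} : Finset (Fin r)) =
          insert ⟨r - (s + 1), by omega⟩ ({i | r - s ≤ Fin.val i} : Finset (Fin r)) := by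
        ext i
        simp only [mem_filter, mem_univ, true_and, mem_insert, Fin.ext_iff]
        omega
      rw [hins, sum_insert (by simp; omega), map_add]
      have ih' := ih (by omega)
      -- The difference is `u (s + 1) * (u (s + 2) - u s)`, one equation of the system: for even `s`
      -- the index of `U` rises from `u s` to `u (s + 2)` and the sign is negative, for odd `s` it
      -- falls and the sign is positive.
      have hstep : u (s + 1) * u (s + 1 + 1) - u s * u (s + 1) =
          C (β ⟨r - (s + 1), by omega⟩) * X := by
        by_cases hs2 : s % 2 = 0
        · have hz : zigzagEquiv r ⟨r - (s + 1), by omega⟩ = ⟨s / 2, by omega⟩ := by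
            ext
            rw [zigzagEquiv_val]
            dsimp only
            rw [if_pos (by omega)]
            omega
          have hodd : Odd (r - (r - (s + 1))) := by rw [Nat.odd_iff]; omega
          have := h ⟨s / 2, by omega⟩
          simp only [hβ, hz, u, if_pos hs2, if_neg (show ¬ (s + 1) % 2 = 0 by omega),
            if_pos (show (s + 1 + 1) % 2 = 0 by omega), hodd.neg_one_pow,
            show (s + 1) / 2 = s / 2 by omega, show (s + 1 + 1) / 2 = s / 2 + 1 by omega,
            neg_one_mul, map_neg]
          linear_combination -this
        · have hz : zigzagEquiv r ⟨r - (s + 1), by omega⟩ = ⟨r - 1 - s / 2, by omega⟩ := by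
            ext
            rw [zigzagEquiv_val]
            dsimp only
            rw [if_neg (by omega)]
            omega
          have heven : Even (r - (r - (s + 1))) := by rw [Nat.even_iff]; omega
          have := h ⟨r - 1 - s / 2, by omega⟩
          simp only [show r - 1 - s / 2 + 1 = r - s / 2 by omega,
            show r - (r - 1 - s / 2) = s / 2 + 1 by omega] at this
          simp only [hβ, hz, u, if_neg hs2, if_pos (show (s + 1) % 2 = 0 by omega),
            if_neg (show ¬ (s + 1 + 1) % 2 = 0 by omega), heven.neg_one_pow,
            show (s + 1) / 2 = s / 2 + 1 by omega, show (s + 1 + 1) / 2 = s / 2 + 1 by omega,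
            one_mul, show r - (s / 2 + 1) = r - 1 - s / 2 by omega]
          linear_combination this
      linear_combination hstep + ih'
  have hmid : u (r + 1) = u r := by
    dsimp only [u]
    split_ifs <;> first | omega | (congr 1; omega)
  have hUr : U r * (U r)⁻¹ = 1 := PowerSeries.mul_inv_cancel _ (by simp [hU])
  set w : ℚ⟦X⟧ := X * (U r)⁻¹ with hw
  have hwU : w * U r = X := by rw [hw, mul_assoc, mul_comm _ (U r), hUr, mul_one]
  have hs : HasSubst w := HasSubst.of_constantCoeff_zero' (by simp [hw])
  -- The telescoping divides by the `u s`, so it takes place in the fraction field; injectivity of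
  -- `ι` brings the result back.
  let ι : ℚ⟦X⟧ →+* FractionRing ℚ⟦X⟧ := algebraMap _ _
  have hι : Function.Injective ι := IsFractionRing.injective _ _
  let ψ : ℚ⟦X⟧ →+* FractionRing ℚ⟦X⟧ :=
    ι.comp ((substAlgHom hs : ℚ⟦X⟧ →ₐ[ℚ] ℚ⟦X⟧) : ℚ⟦X⟧ →+* ℚ⟦X⟧)
  have hψ (f : ℚ⟦X⟧) : ψ f = ι (f.subst w) := by
    simp [ψ, coe_substAlgHom]
  have hne (f : ℚ⟦X⟧) (hf : constantCoeff f = 1) : ι f ≠ 0 := by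
    intro h
    rw [(injective_iff_map_eq_zero ι).mp hι f h, map_zero] at hf
    exact zero_ne_one hf
  -- The sequence is read backwards, from the middle `u (r + 1) = u r`, where the first quotient is
  -- 1, to `u 0 = 1`. The sign `(-1) ^ r` in the exponent makes the remaining factor exactly `U r ^
  -- (-k)`.
  have key := map_alternatingProd ψ (ι (U r)) (hne _ (hU r)) r β ((-1) ^ r * k)
    (fun s => ι (u (r + 1 - s))) (fun s _ => hne _ (hu _)) (fun s hsr => by
      have hp := hprod (r - s) (by omega)
      rw [show r - (r - s) = s by omega, show r - s + 1 = r + 1 - s by omega] at hp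
      rw [eq_div_iff (hne _ (hU r)), ← map_mul, mul_comm (u _),
        show r + 1 - (s + 1) = r - s by omega, hp, hψ, ← map_mul, linearPow_one,
        subst_add hs, subst_mul hs, subst_X hs, ← map_one C, subst_C, subst_C]
      congr 1
      change (C 1 + C _ * w) * U r = _
      rw [map_one, add_mul, mul_assoc, hwU, one_mul])
  have hone : (-1 : ℤ) ^ r * ((-1) ^ r * k) = k := by
    rw [← mul_assoc, ← mul_pow]
    simp
  rw [Nat.sub_zero, Nat.add_sub_cancel, Nat.sub_self, hmid, div_self (hne _ (hu r)), one_zpow,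
    one_mul, hone, hψ, zpow_natCast, show u 0 = 1 by simp [u, h0], map_one, one_pow, one_div,
    inv_pow, ← mul_eq_one_iff_eq_inv₀ (pow_ne_zero _ (hne _ (hU r))), ← map_pow, ← map_mul] at key
  have key' := coeff_eq_of_subst_mul_pow_eq_one (U r) w _ k (hU r) hwU
    (hι (key.trans (map_one ι).symm))
  have hco := coeff_alternatingProd r (k + 1) β ((-1) ^ r * k) 0
  rw [neg_zero, linearPow_zero_right, one_mul, key'] at hco
  rw [eq_neg_iff_add_eq_zero, ← neg_inj, neg_add, hco, neg_zero, add_neg_eq_zero]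
  refine (sum_nbij' (fun l => l ∘ zigzagEquiv r) (fun l => l ∘ (zigzagEquiv r).symm)
    ?_ ?_ ?_ ?_ ?_).symm
  · intro l hl
    rw [Nat.mem_antidiagonalTuple] at hl ⊢
    rw [← hl]
    exact Equiv.sum_comp (zigzagEquiv r) l
  · intro l hl
    rw [Nat.mem_antidiagonalTuple] at hl ⊢
    rw [← hl]
    exact Equiv.sum_comp (zigzagEquiv r).symm l
  · intro l _
    ext
    simp
  · intro l _
    ext
    simp
  · intro l hl
    rw [Nat.mem_antidiagonalTuple] at hl
    rw [← Equiv.prod_comp (zigzagEquiv r)]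
    refine prod_congr rfl fun s _ => ?_
    rw [← choose_zigzagEquiv l k hl s]
    simp only [Function.comp_apply, hβ, mul_pow]
    ring

end PowerSeries

/-! ### The system for λ-plane trees and the final formula -/

/-- The generating function, by number of vertices, of the `λ`-plane trees with root label `y`
(which is `0` if there is no such label). -/
noncomputable def labelSeries (lam : YoungDiagram) (y : ℕ) : PowerSeries ℚ :=
  if h : y < partitionLength lam then
    .X * LabelledPlaneTree.rootSeries (fun x y : Fin (partitionLength lam) =>
      ((x : ℕ), (y : ℕ)) ∈ lam) ⟨y, h⟩
  else 0

open PowerSeries in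
lemma labelSeries_mul (lam : YoungDiagram) (y : ℕ) (hy : y < partitionLength lam)
    (hlen : lam.rowLen y ≤ partitionLength lam) :
    labelSeries lam y * (1 - ∑ z ∈ range (lam.rowLen y), labelSeries lam z) = X := by
  have h := LabelledPlaneTree.rootSeries_eq
    (fun x y : Fin (partitionLength lam) => ((x : ℕ), (y : ℕ)) ∈ lam) ⟨y, hy⟩
  have hsum : ∑ z ∈ range (lam.rowLen y), labelSeries lam z =
      X * ∑ z : Fin (partitionLength lam) with (y, Fin.val z) ∈ lam,
        LabelledPlaneTree.rootSeries (fun x y : Fin (partitionLength lam) =>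
          ((x : ℕ), (y : ℕ)) ∈ lam) z := by
    have hr : range (lam.rowLen y) =
        {z ∈ range (partitionLength lam) | (y, z) ∈ lam} := by
      ext z
      simp only [mem_range, mem_filter, YoungDiagram.mem_iff_lt_rowLen]
      omega
    rw [hr, sum_filter, sum_range, mul_sum, sum_filter]
    refine sum_congr rfl fun z _ => ?_
    simp [labelSeries]
  rw [hsum, labelSeries, dif_pos hy, mul_assoc, h, mul_one]

open PowerSeries in
lemma numLambdaPlaneTrees_eq_coeff (lam : YoungDiagram) (k : ℕ) :
    (numLambdaPlaneTrees lam k : ℚ) =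
      coeff (k + 1) (∑ y ∈ range (partitionLength lam), labelSeries lam y) := by
  simp only [numLambdaPlaneTrees, IsLambdaPlaneTree]
  rw [LabelledPlaneTree.card_trees, sum_range, map_sum, Nat.cast_sum]
  refine sum_congr rfl fun x _ => ?_
  simp [labelSeries, coeff_succ_X_mul, LabelledPlaneTree.rootSeries]

open PowerSeries in
-- All rows `y` of block `i` have length `prefixSum a (r - i)`, so each of its `a i` labels
-- contributes `X` through `labelSeries_mul`.
lemma IsMultirectangular.blockSeries_eq {lam : YoungDiagram} {r : ℕ} {a b : Fin r → ℕ}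
    (hlam : IsMultirectangular lam a b) (hconj : lam.transpose = lam) (i : Fin r) :
    ((1 - ∑ y ∈ range (prefixSum a i), labelSeries lam y) -
        (1 - ∑ y ∈ range (prefixSum a (i + 1)), labelSeries lam y)) *
      (1 - ∑ y ∈ range (prefixSum a (r - i)), labelSeries lam y) = C (a i : ℚ) * X := by
  have hle : prefixSum a i ≤ prefixSum a (i + 1) := prefixSum_mono a (Nat.le_succ _)
  have hlen := hlam.partitionLength_eq hconj
  rw [sub_sub_sub_cancel_left, ← sum_Ico_eq_sub _ hle, sum_mul,
    sum_congr rfl (g := fun _ => X), sum_const, Nat.card_Ico, prefixSum_succ,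
    Nat.add_sub_cancel_left, nsmul_eq_mul, map_natCast]
  intro y hy
  rw [mem_Ico] at hy
  have hrow := hlam.rowLen_eq_prefixSum hconj i y hy.1 hy.2
  rw [← hrow]
  refine labelSeries_mul lam y ?_ ?_
  · rw [hlen]
    exact hy.2.trans_le (prefixSum_mono a i.2)
  · rw [hrow, hlen]
    exact prefixSum_mono a (Nat.sub_le _ _)

theorem theorem3p2 (lam : YoungDiagram) (hconj : lam.transpose = lam)
    (r : ℕ) (a b : Fin r → ℕ) (hlam : IsMultirectangular lam a b) :
    (∀ i : Fin r, b i = sumLE a i.rev) ∧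
    ∀ k : ℕ, 1 ≤ k →
      (numLambdaPlaneTrees lam k : ℚ) =
        ∑ l ∈ Finset.Nat.antidiagonalTuple r (k + 1),
          treeCoeff k l * ∏ i : Fin r, (a i : ℚ) ^ l i := by
  refine ⟨hlam.base_eq hconj, fun k hk => ?_⟩
  have hk0 : (k : ℚ) ≠ 0 := Nat.cast_ne_zero.mpr (by omega)
  have key := PowerSeries.coeff_of_sub_mul_eq (fun i => (a i : ℚ))
    (fun i => 1 - ∑ y ∈ range (prefixSum a i), labelSeries lam y)
    (by simp [prefixSum_zero])
    (fun i => by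
      rw [map_sub, map_sum, sum_eq_zero, map_one, sub_zero]
      intro y _
      rw [labelSeries]
      split_ifs <;> simp)
    (hlam.blockSeries_eq hconj) k
  rw [map_sub, PowerSeries.coeff_one, if_neg k.succ_ne_zero, zero_sub,
    ← hlam.partitionLength_eq hconj, ← numLambdaPlaneTrees_eq_coeff, mul_neg, neg_inj] at key
  rw [← mul_right_inj' hk0, key, mul_sum]
  refine sum_congr rfl fun l _ => ?_
  rw [treeCoeff, prod_mul_distrib, ← mul_assoc, ← mul_assoc, mul_one_div_cancel hk0, one_mul]
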